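/- Let $(M,d)$ be a complete metric space with a distinguished point $0\in M$. Let $\mathrm{Lip}_0(M)$ be the real Banach space of Lipschitz functions $f:M\to\mathbb R$ with $f(0)=0$, normed by the Lipschitz constant $\|f\|_L=\sup\{|f(x)-f(y)|/d(x,y) : x,y\in M,\ x\neq y\}$ (with $\sup\emptyset=0$). For $x\in M$ let $\delta_x\in \mathrm{Lip}_0(M)^*$ be the evaluation $\delta_x(f)=f(x)$, and let the Lipschitz-free space be the norm closure $\mathcal F(M)=\overline{\operatorname{span}}\{\delta_x : x\in M\}\subset \mathrm{Lip}_0(M)^*$ with the dual norm. A metric space is called a length space if, for every pair of points $x,y$, the distance $d(x,y)$ equals the infimum of the lengths of the rectifiable curves joining $x$ and $y$ (the infimum being $\infty$ if there is no such curve). A real Banach space $X$ has the Daugavet property if every bounded linear operator $T:X\to X$ of rank one satisfies $\|T+I\|=1+\|T\|$, where $I$ is the identity operator on $X$. Then the following assertions are equivalent: (i) $M$ is a length space; (ii) $\mathrm{Lip}_0(M)$ has the Daugavet property; (iii) $\mathcal F(M)$ has the Daugavet property. -/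

import Mathlib

noncomputable section

/-- A metric space is a length space if the distance between any two points is the infimum of the
lengths of the rectifiable curves joining them.  The length of a curve is its total variation, and
rectifiable means of finite length.  The infimum is taken in `[0, ∞]`, so that it is `∞` when no
rectifiable curve joins the two points. -/
def IsLengthSpace (M : Type*) [MetricSpace M] : Prop :=
  ∀ x y : M, edist x y =
    ⨅ (γ : Path x y) (_ : BoundedVariationOn γ Set.univ), eVariationOn γ Set.univ

/-- The Daugavet property of a real normed space: every bounded operator `T` of rank one satisfies
the Daugavet equation `‖T + I‖ = 1 + ‖T‖`. -/
def HasDaugavetProperty (X : Type*) [NormedAddCommGroup X] [NormedSpace ℝ X] : Prop :=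
  ∀ T : X →L[ℝ] X, Module.finrank ℝ (LinearMap.range (T : X →ₗ[ℝ] X)) = 1 →
    ‖T + ContinuousLinearMap.id ℝ X‖ = 1 + ‖T‖

/-- The real Lipschitz functions on `M` that vanish at the base point `o`, as a linear subspace of
the space of all real functions on `M`. -/
def lipZeroSubmodule (M : Type*) [MetricSpace M] (o : M) : Submodule ℝ (M → ℝ) where
  carrier := {f | (∃ K : NNReal, LipschitzWith K f) ∧ f o = 0}
  add_mem' := by
    rintro f g ⟨⟨K, hf⟩, hf0⟩ ⟨⟨L, hg⟩, hg0⟩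
    exact ⟨⟨K + L, hf.add hg⟩, by simp [hf0, hg0]⟩
  zero_mem' := ⟨⟨0, LipschitzWith.const 0⟩, rfl⟩
  smul_mem' := by
    rintro c f ⟨⟨K, hf⟩, hf0⟩
    refine ⟨⟨‖c‖₊ * K, ?_⟩, by simp [hf0]⟩
    exact (lipschitzWith_smul c).comp hf

/-- The space `Lip₀(M)` of real Lipschitz functions on the pointed metric space `(M, o)` that
vanish at `o`; it is normed by the Lipschitz constant (see below). -/
def LipZero (M : Type*) [MetricSpace M] (o : M) : Type _ := lipZeroSubmodule M o

namespace LipZero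

variable {M : Type*} [MetricSpace M] {o : M}

instance : AddCommGroup (LipZero M o) := inferInstanceAs (AddCommGroup (lipZeroSubmodule M o))

instance : Module ℝ (LipZero M o) := inferInstanceAs (Module ℝ (lipZeroSubmodule M o))

instance : CoeFun (LipZero M o) (fun _ => M → ℝ) := ⟨fun f => f.1⟩

theorem ext {f g : LipZero M o} (h : ∀ x, f x = g x) : f = g := Subtype.ext (funext h)

theorem add_apply (f g : LipZero M o) (x : M) : (f + g) x = f x + g x := rfl

theorem smul_apply (c : ℝ) (f : LipZero M o) (x : M) : (c • f) x = c * f x := rfl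

theorem zero_apply (x : M) : (0 : LipZero M o) x = 0 := rfl

theorem apply_base (f : LipZero M o) : f o = 0 := f.2.2

/-- The norm of `f` is its Lipschitz constant, the supremum of all slopes
`|f x - f y| / d(x, y)` with `x ≠ y` (it is `0` when `M` is a single point). -/
instance : Norm (LipZero M o) :=
  ⟨fun f => sSup {r : ℝ | ∃ x y : M, x ≠ y ∧ r = |f x - f y| / dist x y}⟩

theorem norm_def (f : LipZero M o) :
    ‖f‖ = sSup {r : ℝ | ∃ x y : M, x ≠ y ∧ r = |f x - f y| / dist x y} := rfl

theorem bddAbove_slopes (f : LipZero M o) :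
    BddAbove {r : ℝ | ∃ x y : M, x ≠ y ∧ r = |f x - f y| / dist x y} := by
  obtain ⟨K, hK⟩ := f.2.1
  refine ⟨K, ?_⟩
  rintro r ⟨x, y, hxy, rfl⟩
  rw [div_le_iff₀ (dist_pos.2 hxy), ← Real.dist_eq]
  exact hK.dist_le_mul x y

theorem norm_nonneg' (f : LipZero M o) : 0 ≤ ‖f‖ := by
  apply Real.sSup_nonneg
  rintro r ⟨x, y, -, rfl⟩
  positivity

theorem abs_sub_le (f : LipZero M o) (x y : M) : |f x - f y| ≤ ‖f‖ * dist x y := by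
  rcases eq_or_ne x y with rfl | h
  · simp
  · rw [← div_le_iff₀ (dist_pos.2 h)]
    exact le_csSup f.bddAbove_slopes ⟨x, y, h, rfl⟩

theorem norm_le_of_forall (f : LipZero M o) {C : ℝ} (hC : 0 ≤ C)
    (h : ∀ x y, |f x - f y| ≤ C * dist x y) : ‖f‖ ≤ C := by
  apply Real.sSup_le _ hC
  rintro r ⟨x, y, hxy, rfl⟩
  rw [div_le_iff₀ (dist_pos.2 hxy)]
  exact h x y

theorem norm_smul_le' (c : ℝ) (f : LipZero M o) : ‖c • f‖ ≤ |c| * ‖f‖ := by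
  refine norm_le_of_forall _ (mul_nonneg (abs_nonneg c) f.norm_nonneg') fun x y => ?_
  rw [smul_apply, smul_apply, ← mul_sub, abs_mul, mul_assoc]
  exact mul_le_mul_of_nonneg_left (f.abs_sub_le x y) (abs_nonneg c)

theorem normedSpaceCore : NormedSpace.Core ℝ (LipZero M o) where
  norm_nonneg := norm_nonneg'
  norm_smul c f := by
    refine le_antisymm (norm_smul_le' c f) ?_
    rcases eq_or_ne c 0 with rfl | hc
    · simpa using norm_nonneg' ((0 : ℝ) • f)
    · have h := norm_smul_le' c⁻¹ (c • f)
      rw [inv_smul_smul₀ hc, abs_inv, inv_mul_eq_div, le_div_iff₀ (abs_pos.2 hc)] at h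
      rw [Real.norm_eq_abs, mul_comm]
      exact h
  norm_triangle f g := by
    refine norm_le_of_forall _ (add_nonneg f.norm_nonneg' g.norm_nonneg') fun x y => ?_
    rw [add_apply, add_apply, add_sub_add_comm, add_mul]
    exact (abs_add_le _ _).trans (add_le_add (f.abs_sub_le x y) (g.abs_sub_le x y))
  norm_eq_zero_iff f := by
    constructor
    · intro h
      refine ext fun x => ?_
      have hx := f.abs_sub_le x o
      rw [h, zero_mul, apply_base, sub_zero] at hx
      exact abs_nonpos_iff.1 hx
    · rintro rfl
      refine le_antisymm (norm_le_of_forall _ le_rfl fun x y => ?_) (norm_nonneg' _)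
      simp [zero_apply]

instance : NormedAddCommGroup (LipZero M o) := NormedAddCommGroup.ofCore normedSpaceCore

instance : NormedSpace ℝ (LipZero M o) := NormedSpace.ofCore normedSpaceCore

variable (o) in
/-- The evaluation functional `δ_x : f ↦ f x` on `Lip₀(M)`. -/
def delta (x : M) : StrongDual ℝ (LipZero M o) :=
  LinearMap.mkContinuous
    { toFun := fun f => f x
      map_add' := fun _ _ => rfl
      map_smul' := fun _ _ => rfl } (dist x o) (fun f => by
        have h := f.abs_sub_le x o
        rw [apply_base, sub_zero, mul_comm] at h
        exact h)

theorem delta_apply (x : M) (f : LipZero M o) : delta o x f = f x := rfl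

end LipZero

/-- The Lipschitz-free space `F(M)`: the norm closure of the linear span of the evaluation
functionals in the dual of `Lip₀(M)`, with the dual norm. -/
abbrev LipschitzFreeSpace (M : Type*) [MetricSpace M] (o : M) :
    Submodule ℝ (StrongDual ℝ (LipZero M o)) :=
  (Submodule.span ℝ (Set.range (LipZero.delta o))).topologicalClosure

end

/-! The theorem is proved in the circle length space ⇒ `Lip₀(M)` ⇒ `F(M)` ⇒ length space, where
length spaces enter through approximate midpoints: a complete metric space is a length space if and
only if any two points have approximate midpoints (`IsLengthSpace.hasApproxMidpoints`,
`HasApproxMidpoints.isLengthSpace`), since repeated bisection gives Lipschitz curves of almost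
minimal length.  A rank one operator is `φ ⊗ g`, so that the Daugavet property says
`‖I + φ ⊗ g‖ = 1 + ‖φ‖ ‖g‖` for all nonzero `φ` and `g`.

Length space ⇒ `Lip₀(M)`.  On an almost geodesic curve between points at which `g` almost attains
its norm, `g` almost attains its norm at many pairs of points that are far apart from each other but
have two close members (`LipZero.exists_separated_steep_pairs`).  A function `f` that almost norms
`φ` can be given slope `1` at each of these pairs by changes with disjoint supports.  The signed
sums of the changes are bounded, so one of the changes hardly affects `φ`
(`exists_abs_dual_apply_le`).  The slope of the image of the changed function at its pair shows that
the norm of `I + φ ⊗ g` is almost `1 + ‖φ‖ ‖g‖`.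

`Lip₀(M)` ⇒ `F(M)`.  The dual of `F(M)` is `Lip₀(M)`, and an operator of the form `I + φ ⊗ m` on
`F(M)` has an adjoint of the same form on `Lip₀(M)` (`FreePresentation.hasDaugavetProperty`).

`F(M)` ⇒ length space.  If `x` and `y` have no approximate midpoint, the difference `f` of two
peaks of height `d(x, y) / 2` at `x` and `y`, of slope slightly less than `1`, almost has norm `1`,
and it is steep only at pairs `(t, s)` with `t` in the support of the first peak and `s` in that of
the second one.  These supports have positive distance, so that `d(x, t) + d(s, y)` is about
`d(x, y) - d(t, s)` and well below `d(x, y) + d(t, s)`.  The Daugavet equation for `f ⊗ m`, with `m`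
the molecule of `(y, x)`, however, gives a steep pair for which `d(x, t) + d(s, y)` is almost
`d(x, y) + d(t, s)` (`FreePresentation.exists_molecule`). -/

open Filter Topology

/-! ### Length spaces and approximate midpoints -/

/-- Approximate midpoints exist: for all `x`, `y` and `ε > 0` some `z` has distance at most
`(1 + ε) d(x, y) / 2` from both `x` and `y`. -/
def HasApproxMidpoints (M : Type*) [MetricSpace M] : Prop :=
  ∀ x y : M, ∀ ε : ℝ, 0 < ε → ∃ z, dist x z ≤ (1 + ε) * (dist x y / 2) ∧
    dist z y ≤ (1 + ε) * (dist x y / 2)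

section Curves

variable {M : Type*} [MetricSpace M]

theorem IsLengthSpace.hasApproxMidpoints (hM : IsLengthSpace M) : HasApproxMidpoints M := by
  intro x y ε hε
  rcases eq_or_ne x y with rfl | hxy
  · exact ⟨x, by simp⟩
  have hd : 0 < dist x y := dist_pos.2 hxy
  have hlt : edist x y < ENNReal.ofReal ((1 + ε) * dist x y) := by
    rw [edist_dist, ENNReal.ofReal_lt_ofReal_iff (by positivity)]
    nlinarith
  rw [hM x y] at hlt
  simp only [iInf_lt_iff] at hlt
  obtain ⟨γ, -, hγ⟩ := hlt
  -- a point of the curve equidistant from its two ends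
  obtain ⟨t, ht⟩ : ∃ t, dist x (γ t) - dist (γ t) y = 0 := by
    have hc : Continuous fun t => dist x (γ t) - dist (γ t) y := by fun_prop
    have := mem_range_of_exists_le_of_exists_ge hc (c := 0)
      ⟨0, by simp⟩ ⟨1, by simp⟩
    exact this
  have hsum : edist x (γ t) + edist (γ t) y ≤ eVariationOn γ Set.univ := by
    have h1 : edist x (γ t) ≤ eVariationOn γ (Set.univ ∩ Set.Iic t) := by
      simpa using eVariationOn.edist_le γ (s := Set.univ ∩ Set.Iic t) (x := 0) (y := t)
        ⟨trivial, unitInterval.nonneg'⟩ ⟨trivial, le_refl t⟩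
    have h2 : edist (γ t) y ≤ eVariationOn γ (Set.univ ∩ Set.Ici t) := by
      simpa using eVariationOn.edist_le γ (s := Set.univ ∩ Set.Ici t) (x := t) (y := 1)
        ⟨trivial, le_refl t⟩ ⟨trivial, unitInterval.le_one'⟩
    refine (add_le_add h1 h2).trans ?_
    refine (eVariationOn.add_le_union γ ?_).trans (eVariationOn.mono _ (by simp))
    rintro a ⟨-, ha⟩ b ⟨-, hb⟩
    exact le_trans ha hb
  have hlt := hsum.trans_lt hγ
  rw [edist_dist, edist_dist, ← ENNReal.ofReal_add dist_nonneg dist_nonneg,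
    ENNReal.ofReal_lt_ofReal_iff (by positivity)] at hlt
  exact ⟨γ t, by linarith, by linarith⟩

/-- The step-function approximations of a curve from `a` to `b` by `n`-fold bisection, where
`mid k` chooses the approximate midpoints at level `k` and the bisection starts at level `k`. -/
noncomputable def bisectionCurve {M : Type*} (mid : ℕ → M → M → M) : ℕ → ℕ → M → M → ℝ → M
  | 0, _, a, b, t => if t < 1 then a else b
  | n + 1, k, a, b, t =>
    if t < 1 / 2 then bisectionCurve mid n (k + 1) a (mid k a b) (2 * t)
    else bisectionCurve mid n (k + 1) (mid k a b) b (2 * t - 1)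

theorem bisectionCurve_zero {M : Type*} (mid : ℕ → M → M → M) (n k : ℕ) (a b : M) :
    bisectionCurve mid n k a b 0 = a := by
  induction n generalizing k a b with
  | zero => simp [bisectionCurve]
  | succ n ih => simp [bisectionCurve, ih]

theorem bisectionCurve_one {M : Type*} (mid : ℕ → M → M → M) (n k : ℕ) (a b : M) :
    bisectionCurve mid n k a b 1 = b := by
  induction n generalizing k a b with
  | zero => simp [bisectionCurve]
  | succ n ih =>
    have h2 : (2 * 1 - 1 : ℝ) = 1 := by norm_num
    rw [bisectionCurve, if_neg (by norm_num), h2, ih]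

theorem dist_bisectionCurve_succ_le {mid : ℕ → M → M → M} {L : ℕ → ℝ} (hL : ∀ k, 1 ≤ L k)
    (hmid₁ : ∀ k a b, L (k + 1) * dist a (mid k a b) ≤ L k * (dist a b / 2))
    (hmid₂ : ∀ k a b, L (k + 1) * dist (mid k a b) b ≤ L k * (dist a b / 2))
    (n k : ℕ) (a b : M) (t : ℝ) :
    dist (bisectionCurve mid n k a b t) (bisectionCurve mid (n + 1) k a b t) ≤
      L k * dist a b * (1 / 2) ^ n := by
  induction n generalizing k a b t with
  | zero =>
    have hd : 0 ≤ L k * dist a b := mul_nonneg (zero_le_one.trans (hL k)) dist_nonneg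
    have h := hmid₁ k a b
    have h' : 1 * dist a (mid k a b) ≤ L (k + 1) * dist a (mid k a b) :=
      mul_le_mul_of_nonneg_right (hL _) dist_nonneg
    simp only [bisectionCurve]
    split_ifs <;> simp <;> linarith
  | succ n ih =>
    rw [bisectionCurve, bisectionCurve.eq_def mid (n + 1 + 1)]
    simp only
    split_ifs
    · refine (ih _ _ _ _).trans ?_
      rw [pow_succ]
      have := mul_le_mul_of_nonneg_right (hmid₁ k a b) (by positivity : (0 : ℝ) ≤ (1 / 2) ^ n)
      linarith
    · refine (ih _ _ _ _).trans ?_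
      rw [pow_succ]
      have := mul_le_mul_of_nonneg_right (hmid₂ k a b) (by positivity : (0 : ℝ) ≤ (1 / 2) ^ n)
      linarith

theorem le_mul_of_forall_add_pow {x A B C : ℝ}
    (h : ∀ n : ℕ, x ≤ A * (B + C * (1 / 2) ^ n)) : x ≤ A * B := by
  have hlim : Tendsto (fun n : ℕ => A * (B + C * (1 / 2 : ℝ) ^ n)) atTop
      (𝓝 (A * (B + C * 0))) :=
    ((tendsto_pow_atTop_nhds_zero_of_lt_one (by norm_num) (by norm_num)).const_mul C
      |>.const_add B).const_mul A
  simpa using ge_of_tendsto' hlim h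

/-- The limit of the bisection curves is Lipschitz.  A bisection at level `k` loses the factor
`L k / L (k + 1)`, and these factors telescope, so that the curve from `a` to `b` started at
level `k` has Lipschitz constant `L k * dist a b`. -/
theorem exists_lipschitz_curve_of_mid [CompleteSpace M] {mid : ℕ → M → M → M} {L : ℕ → ℝ}
    (hL : ∀ k, 1 ≤ L k)
    (hmid₁ : ∀ k a b, L (k + 1) * dist a (mid k a b) ≤ L k * (dist a b / 2))
    (hmid₂ : ∀ k a b, L (k + 1) * dist (mid k a b) b ≤ L k * (dist a b / 2)) (a b : M) :
    ∃ G : ℝ → M, G 0 = a ∧ G 1 = b ∧ ∀ s t, 0 ≤ s → s ≤ t → t ≤ 1 →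
      dist (G s) (G t) ≤ L 0 * dist a b * (t - s) := by
  have hstep := dist_bisectionCurve_succ_le hL hmid₁ hmid₂
  have hlim : ∀ k a b t, ∃ z, Tendsto (fun n => bisectionCurve mid n k a b t) atTop (𝓝 z) :=
    fun k a b t => cauchySeq_tendsto_of_complete
      (cauchySeq_of_le_geometric (1 / 2) _ (by norm_num) fun n => hstep n k a b t)
  choose G hG using hlim
  have hG0 : ∀ k a b, G k a b 0 = a := fun k a b =>
    tendsto_nhds_unique (hG k a b 0) (by simp [bisectionCurve_zero])
  have hG1 : ∀ k a b, G k a b 1 = b := fun k a b =>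
    tendsto_nhds_unique (hG k a b 1) (by simp [bisectionCurve_one])
  have hleft : ∀ k a b t, t < 1 / 2 → G k a b t = G (k + 1) a (mid k a b) (2 * t) := by
    intro k a b t ht
    refine tendsto_nhds_unique ((tendsto_add_atTop_iff_nat 1).2 (hG k a b t)) ?_
    simpa only [bisectionCurve, if_pos ht] using hG (k + 1) a (mid k a b) (2 * t)
  have hright : ∀ k a b t, ¬ t < 1 / 2 → G k a b t = G (k + 1) (mid k a b) b (2 * t - 1) := by
    intro k a b t ht
    refine tendsto_nhds_unique ((tendsto_add_atTop_iff_nat 1).2 (hG k a b t)) ?_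
    simpa only [bisectionCurve, if_neg ht] using hG (k + 1) (mid k a b) b (2 * t - 1)
  have hLd : ∀ k (a b : M), 0 ≤ L k * dist a b := fun k a b =>
    mul_nonneg (zero_le_one.trans (hL k)) dist_nonneg
  have hLd' : ∀ k (a b : M), dist a b ≤ L k * dist a b := fun k a b =>
    le_mul_of_one_le_left dist_nonneg (hL k)
  have hcrude : ∀ k a b t, dist (G k a b t) a ≤ L k * dist a b * 3 ∧
      dist (G k a b t) b ≤ L k * dist a b * 3 := by
    intro k a b t
    have h := dist_le_of_le_geometric_of_tendsto₀ (1 / 2) _ (by norm_num)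
      (fun n => hstep n k a b t) (hG k a b t)
    have h0 : dist (bisectionCurve mid 0 k a b t) a ≤ L k * dist a b ∧
        dist (bisectionCurve mid 0 k a b t) b ≤ L k * dist a b := by
      simp only [bisectionCurve]
      split_ifs
      · simpa using ⟨hLd k a b, hLd' k a b⟩
      · simpa [dist_comm b a] using ⟨hLd' k a b, hLd k a b⟩
    rw [dist_comm, show (1 : ℝ) - 1 / 2 = 1 / 2 by norm_num, div_eq_mul_inv] at h
    norm_num at h
    have h1 := dist_triangle (G k a b t) (bisectionCurve mid 0 k a b t) a
    have h2 := dist_triangle (G k a b t) (bisectionCurve mid 0 k a b t) b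
    constructor <;> linarith
  -- distances from the two ends, up to an error that is halved by each bisection
  have hends : ∀ k a b t, 0 ≤ t → t ≤ 1 → dist (G k a b t) a ≤ L k * dist a b * t ∧
      dist (G k a b t) b ≤ L k * dist a b * (1 - t) := by
    have key : ∀ (n k : ℕ) a b t, 0 ≤ t → t ≤ 1 →
        dist (G k a b t) a ≤ L k * dist a b * (t + 3 * (1 / 2) ^ n) ∧
        dist (G k a b t) b ≤ L k * dist a b * (1 - t + 3 * (1 / 2) ^ n) := by
      intro n
      induction n with
      | zero =>
        intro k a b t ht0 ht1
        have h := hcrude k a b t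
        have := mul_nonneg (hLd k a b) ht0
        have := mul_nonneg (hLd k a b) (sub_nonneg.2 ht1)
        constructor <;> norm_num <;> linarith
      | succ n ih =>
        intro k a b t ht0 ht1
        have hp : (0 : ℝ) ≤ (1 / 2) ^ n := by positivity
        have m1 := hmid₁ k a b
        have m2 := hmid₂ k a b
        by_cases ht : t < 1 / 2
        · rw [hleft k a b t ht]
          obtain ⟨h1, h2⟩ := ih (k + 1) a (mid k a b) (2 * t) (by linarith) (by linarith)
          have e1 := mul_le_mul_of_nonneg_right m1
            (by positivity : 0 ≤ 2 * t + 3 * (1 / 2 : ℝ) ^ n)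
          have e2 := mul_le_mul_of_nonneg_right m1
            (by linarith : 0 ≤ 1 - 2 * t + 3 * (1 / 2 : ℝ) ^ n)
          have e3 := hLd' (k + 1) (mid k a b) b
          have e4 := dist_triangle (G (k + 1) a (mid k a b) (2 * t)) (mid k a b) b
          rw [pow_succ]
          constructor <;> linarith
        · rw [hright k a b t ht]
          obtain ⟨h1, h2⟩ := ih (k + 1) (mid k a b) b (2 * t - 1) (by linarith) (by linarith)
          have e1 := mul_le_mul_of_nonneg_right m2
            (by linarith : 0 ≤ 2 * t - 1 + 3 * (1 / 2 : ℝ) ^ n)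
          have e2 := mul_le_mul_of_nonneg_right m2
            (by linarith : 0 ≤ 1 - (2 * t - 1) + 3 * (1 / 2 : ℝ) ^ n)
          have e3 := hLd' (k + 1) a (mid k a b)
          have e4 := dist_triangle (G (k + 1) (mid k a b) b (2 * t - 1)) (mid k a b) a
          rw [dist_comm (mid k a b) a] at e4
          rw [pow_succ]
          constructor <;> linarith
    exact fun k a b t ht0 ht1 => ⟨le_mul_of_forall_add_pow fun n => (key n k a b t ht0 ht1).1,
      le_mul_of_forall_add_pow fun n => (key n k a b t ht0 ht1).2⟩
  have key : ∀ (n k : ℕ) a b s t, 0 ≤ s → s ≤ t → t ≤ 1 →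
      dist (G k a b s) (G k a b t) ≤ L k * dist a b * (t - s + 6 * (1 / 2) ^ n) := by
    intro n
    induction n with
    | zero =>
      intro k a b s t hs hst ht
      have h1 := (hcrude k a b s).1
      have h2 := (hcrude k a b t).1
      have h3 := dist_triangle_right (G k a b s) (G k a b t) a
      have := mul_nonneg (hLd k a b) (sub_nonneg.2 hst)
      norm_num
      linarith
    | succ n ih =>
      intro k a b s t hs hst ht
      have hp : (0 : ℝ) ≤ (1 / 2) ^ n := by positivity
      have m1 := hmid₁ k a b
      have m2 := hmid₂ k a b
      rw [pow_succ]
      by_cases ht2 : t < 1 / 2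
      · rw [hleft k a b t ht2, hleft k a b s (by linarith)]
        have h := ih (k + 1) a (mid k a b) (2 * s) (2 * t) (by linarith) (by linarith)
          (by linarith)
        have e := mul_le_mul_of_nonneg_right m1
          (by linarith : 0 ≤ 2 * t - 2 * s + 6 * (1 / 2 : ℝ) ^ n)
        linarith
      · by_cases hs2 : s < 1 / 2
        · rw [hright k a b t ht2, hleft k a b s hs2]
          -- the curve passes through `mid k a b` between the times `s` and `t`
          have h1 := (hends (k + 1) a (mid k a b) (2 * s) (by linarith) (by linarith)).2
          have h2 := (hends (k + 1) (mid k a b) b (2 * t - 1) (by linarith) (by linarith)).1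
          have h3 := dist_triangle_right (G (k + 1) a (mid k a b) (2 * s))
            (G (k + 1) (mid k a b) b (2 * t - 1)) (mid k a b)
          have e1 := mul_le_mul_of_nonneg_right m1 (by linarith : 0 ≤ 1 - 2 * s)
          have e2 := mul_le_mul_of_nonneg_right m2 (by linarith : 0 ≤ 2 * t - 1)
          have := mul_nonneg (hLd k a b) hp
          linarith
        · rw [hright k a b t ht2, hright k a b s hs2]
          have h := ih (k + 1) (mid k a b) b (2 * s - 1) (2 * t - 1) (by linarith) (by linarith)
            (by linarith)
          have e := mul_le_mul_of_nonneg_right m2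
            (by linarith : 0 ≤ 2 * t - 1 - (2 * s - 1) + 6 * (1 / 2 : ℝ) ^ n)
          linarith
  exact ⟨G 0 a b, hG0 0 a b, hG1 0 a b, fun s t hs hst ht =>
    le_mul_of_forall_add_pow fun n => key n 0 a b s t hs hst ht⟩

theorem HasApproxMidpoints.exists_lipschitz_curve [CompleteSpace M] (hM : HasApproxMidpoints M)
    (a b : M) {ε : ℝ} (hε : 0 < ε) :
    ∃ G : ℝ → M, G 0 = a ∧ G 1 = b ∧ ∀ s t, 0 ≤ s → s ≤ t → t ≤ 1 →
      dist (G s) (G t) ≤ (1 + ε) * dist a b * (t - s) := by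
  -- the constants decrease to `1`, which leaves room for an error in every bisection
  set L : ℕ → ℝ := fun k => 1 + ε * (1 / 2) ^ k with hLdef
  have hL : ∀ k, 1 ≤ L k := fun k => by
    have : 0 < ε * (1 / 2 : ℝ) ^ k := by positivity
    simp only [hLdef]; linarith
  have hmid : ∀ (k : ℕ) (a b : M), ∃ z, L (k + 1) * dist a z ≤ L k * (dist a b / 2) ∧
      L (k + 1) * dist z b ≤ L k * (dist a b / 2) := by
    intro k a b
    have hlt : L (k + 1) < L k := by
      have : 0 < ε * (1 / 2 : ℝ) ^ k := by positivity
      simp only [hLdef, pow_succ]; linarith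
    have hpos : 0 < L (k + 1) := zero_lt_one.trans_le (hL _)
    obtain ⟨z, h1, h2⟩ := hM a b ((L k - L (k + 1)) / L (k + 1))
      (div_pos (sub_pos.2 hlt) hpos)
    have e : L (k + 1) * (1 + (L k - L (k + 1)) / L (k + 1)) = L k := by
      field_simp; ring
    refine ⟨z, ?_, ?_⟩
    · calc _ ≤ L (k + 1) * _ := mul_le_mul_of_nonneg_left h1 hpos.le
        _ = _ := by rw [← mul_assoc, e]
    · calc _ ≤ L (k + 1) * _ := mul_le_mul_of_nonneg_left h2 hpos.le
        _ = _ := by rw [← mul_assoc, e]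
  choose mid hmid₁ hmid₂ using hmid
  simpa [hLdef] using exists_lipschitz_curve_of_mid hL hmid₁ hmid₂ a b

theorem HasApproxMidpoints.isLengthSpace [CompleteSpace M] (hM : HasApproxMidpoints M) :
    IsLengthSpace M := by
  intro x y
  apply le_antisymm
  · refine le_iInf₂ fun γ _ => ?_
    simpa using eVariationOn.edist_le γ (Set.mem_univ 0) (Set.mem_univ 1)
  refine ENNReal.le_of_forall_pos_le_add fun e he _ => ?_
  set ε : ℝ := e / (dist x y + 1) with hεdef
  have hε : 0 < ε := div_pos he (by positivity)
  obtain ⟨G, hG0, hG1, hG⟩ := hM.exists_lipschitz_curve x y hε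
  have hK : 0 ≤ (1 + ε) * dist x y := by positivity
  set K : NNReal := ⟨(1 + ε) * dist x y, hK⟩ with hKdef
  have hlip : LipschitzWith K fun t : unitInterval => G t := by
    refine LipschitzWith.of_dist_le_mul fun s t => ?_
    rw [Subtype.dist_eq, Real.dist_eq]
    rcases le_total s t with h | h
    · have h' : (s : ℝ) ≤ t := h
      rw [abs_sub_comm, abs_of_nonneg (sub_nonneg.2 h')]
      exact hG s t s.2.1 h t.2.2
    · have h' : (t : ℝ) ≤ s := h
      rw [abs_of_nonneg (sub_nonneg.2 h'), dist_comm]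
      exact hG t s t.2.1 h s.2.2
  let γ : Path x y := ⟨⟨fun t => G t, hlip.continuous⟩, by simpa using hG0, by simpa using hG1⟩
  have hid : eVariationOn (id : unitInterval → unitInterval) Set.univ ≤ 1 := by
    have h1 : eVariationOn (id : unitInterval → unitInterval) Set.univ =
        eVariationOn (fun t : unitInterval => (t : ℝ)) Set.univ := rfl
    have h2 : MonotoneOn (fun t : unitInterval => (t : ℝ)) Set.univ := fun _ _ _ _ h => h
    have h3 := h2.eVariationOn_eq (Set.mem_univ 0) (Set.mem_univ 1)
    have h4 : (Set.univ ∩ Set.Icc 0 1 : Set unitInterval) = Set.univ := by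
      ext t; simp [unitInterval.le_one']
    rw [h4] at h3
    simp [h1, h3]
  have hvar : eVariationOn γ Set.univ ≤ K := by
    have h := (hlip.lipschitzOnWith (s := Set.univ)).comp_eVariationOn_le
      (Set.mapsTo_univ (id : unitInterval → unitInterval) Set.univ)
    refine h.trans ?_
    simpa using mul_le_mul_right hid (K : ENNReal)
  have hbv : BoundedVariationOn γ Set.univ := ne_top_of_le_ne_top ENNReal.coe_ne_top hvar
  refine (iInf₂_le γ hbv).trans (hvar.trans ?_)
  have hKe : (K : ℝ) ≤ dist x y + e := by
    have : ε * dist x y ≤ e := by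
      rw [hεdef, div_mul_eq_mul_div, div_le_iff₀ (by positivity)]
      have : (0 : ℝ) < e := he
      nlinarith
    change (1 + ε) * dist x y ≤ _
    linarith
  rw [edist_nndist, ← ENNReal.coe_add, ENNReal.coe_le_coe, ← NNReal.coe_le_coe]
  simpa using hKe

end Curves

/-! ### Rank one operators and duality -/

section Daugavet

variable {X : Type*} [NormedAddCommGroup X] [NormedSpace ℝ X]

theorem hasDaugavetProperty_of_forall_smulRight
    (h : ∀ (φ : StrongDual ℝ X) (g : X), φ ≠ 0 → g ≠ 0 →
      1 + ‖φ‖ * ‖g‖ ≤ ‖φ.smulRight g + ContinuousLinearMap.id ℝ X‖) :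
    HasDaugavetProperty X := by
  intro T hT
  obtain ⟨⟨g, hg⟩, hg0, hspan⟩ := finrank_eq_one_iff'.1 hT
  replace hg0 : g ≠ 0 := fun h => hg0 (Subtype.ext h)
  have hT' : ∀ x, ∃ c : ℝ, c • g = T x := by
    intro x
    obtain ⟨c, hc⟩ := hspan ⟨T x, ⟨x, rfl⟩⟩
    exact ⟨c, congrArg Subtype.val hc⟩
  -- the coefficient functional is a multiple of `ψ ∘ T`, hence continuous
  obtain ⟨ψ, -, hψ⟩ := exists_dual_vector ℝ g (norm_ne_zero_iff.2 hg0)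
  have hgn : ‖g‖ ≠ 0 := norm_ne_zero_iff.2 hg0
  have hTeq : T = ((‖g‖⁻¹) • ψ.comp T).smulRight g := by
    ext x
    obtain ⟨c, hc⟩ := hT' x
    have hψ' : ψ g = ‖g‖ := by simpa using hψ
    simp [← hc, hψ', mul_comm c, inv_mul_cancel_left₀ hgn]
  set φ : StrongDual ℝ X := (‖g‖⁻¹) • ψ.comp T
  have hφ : φ ≠ 0 := by
    intro h0
    obtain ⟨x, hx⟩ := hg
    refine hg0 ?_
    rw [← hx, hTeq, h0]
    simp
  rw [hTeq]
  refine le_antisymm ?_ ?_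
  · refine (norm_add_le _ _).trans ?_
    rw [add_comm]
    exact add_le_add_left ContinuousLinearMap.norm_id_le _
  · rw [ContinuousLinearMap.norm_smulRight_apply]
    exact h φ g hφ hg0

theorem HasDaugavetProperty.norm_smulRight_add_id (h : HasDaugavetProperty X)
    {φ : StrongDual ℝ X} {g : X} (hφ : φ ≠ 0) (hg : g ≠ 0) :
    ‖φ.smulRight g + ContinuousLinearMap.id ℝ X‖ = 1 + ‖φ‖ * ‖g‖ := by
  rw [h (φ.smulRight g), ContinuousLinearMap.norm_smulRight_apply]
  obtain ⟨x, hx⟩ : ∃ x, φ x ≠ 0 := by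
    by_contra! h0
    exact hφ (ContinuousLinearMap.ext h0)
  refine finrank_eq_one_iff'.2 ⟨⟨φ x • g, ⟨x, rfl⟩⟩, ?_, ?_⟩
  · intro h0
    exact smul_ne_zero hx hg (congrArg Subtype.val h0)
  · rintro ⟨_, ⟨y, rfl⟩⟩
    refine ⟨φ y / φ x, Subtype.ext ?_⟩
    simp [smul_smul, div_mul_cancel₀ _ hx]

end Daugavet

section FreeSpace

variable {M : Type*} [MetricSpace M] {o : M}

namespace LipZero

variable (o) in
/-- The element `f - f o` of `Lip₀(M)` given by a Lipschitz function `f`. -/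
noncomputable def ofLipschitz (f : M → ℝ) (h : ∃ K : NNReal, LipschitzWith K f) : LipZero M o :=
  (⟨fun x => f x - f o, by
    obtain ⟨K, hK⟩ := h
    refine ⟨⟨K, LipschitzWith.of_dist_le_mul fun x y => ?_⟩, sub_self _⟩
    simpa using hK.dist_le_mul x y⟩ : lipZeroSubmodule M o)

theorem ofLipschitz_apply (f : M → ℝ) (h : ∃ K : NNReal, LipschitzWith K f) (x : M) :
    ofLipschitz o f h x = f x - f o := rfl

theorem sum_apply {ι : Type*} (s : Finset ι) (f : ι → LipZero M o) (x : M) :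
    (∑ i ∈ s, f i) x = ∑ i ∈ s, f i x := by
  simpa only [delta_apply] using map_sum (delta o x) f s

end LipZero

open LipZero

theorem exists_lipschitzWith_of_abs_sub_le {f : M → ℝ} {C : ℝ} (hC : 0 ≤ C)
    (h : ∀ x y, |f x - f y| ≤ C * dist x y) : ∃ K : NNReal, LipschitzWith K f :=
  ⟨⟨C, hC⟩, LipschitzWith.of_dist_le_mul h⟩

/-- A presentation of a normed space `X` as the Lipschitz-free space of `M`: a linear isometry
of `X` into `Lip₀(M)*` and points `δ x` of `X` with dense span that it sends to the evaluation
functionals. -/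
structure FreePresentation (M : Type*) [MetricSpace M] (o : M) (X : Type*)
    [NormedAddCommGroup X] [NormedSpace ℝ X] where
  ι : X →ₗᵢ[ℝ] StrongDual ℝ (LipZero M o)
  δ : M → X
  ι_δ : ∀ x, ι (δ x) = delta o x
  dense_span : Dense (Submodule.span ℝ (Set.range δ) : Set X)

variable (M o) in
/-- The Lipschitz-free space, presented by its inclusion into `Lip₀(M)*`. -/
noncomputable def freePresentation : FreePresentation M o (LipschitzFreeSpace M o) where
  ι := (LipschitzFreeSpace M o).subtypeₗᵢ
  δ x := ⟨delta o x, Submodule.le_topologicalClosure _ (Submodule.subset_span ⟨x, rfl⟩)⟩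
  ι_δ _ := rfl
  dense_span := by
    refine Subtype.dense_iff.2 fun m hm => closure_mono (fun a ha => ?_) hm
    rw [← Submodule.coe_subtype, ← Submodule.map_coe, Submodule.map_span, ← Set.range_comp]
    exact ha

namespace FreePresentation

variable {X : Type*} [NormedAddCommGroup X] [NormedSpace ℝ X] (P : FreePresentation M o X)

theorem ι_apply_δ (x : M) (f : LipZero M o) : P.ι (P.δ x) f = f x := by
  rw [P.ι_δ, delta_apply]

theorem ι_apply_δ_sub (x y : M) (f : LipZero M o) : P.ι (P.δ x - P.δ y) f = f x - f y := by
  rw [map_sub, _root_.sub_apply, P.ι_apply_δ, P.ι_apply_δ]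

theorem abs_ι_apply_le (m : X) (f : LipZero M o) : |P.ι m f| ≤ ‖m‖ * ‖f‖ := by
  rw [← P.ι.norm_map]
  exact (P.ι m).le_opNorm f

theorem norm_le_of_forall (m : X) {C : ℝ} (hC : 0 ≤ C) (h : ∀ f, |P.ι m f| ≤ C * ‖f‖) :
    ‖m‖ ≤ C := by
  rw [← P.ι.norm_map]
  exact ContinuousLinearMap.opNorm_le_bound _ hC h

theorem norm_δ_sub_le (x y : M) : ‖P.δ x - P.δ y‖ ≤ dist x y := by
  refine P.norm_le_of_forall _ dist_nonneg fun f => ?_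
  rw [P.ι_apply_δ_sub, mul_comm]
  exact f.abs_sub_le x y

theorem δ_base : P.δ o = 0 := by
  refine P.ι.injective ?_
  rw [P.ι_δ, map_zero]
  exact ContinuousLinearMap.ext fun f => f.apply_base

/-- The functional `m ↦ m(f)` on the Lipschitz-free space. -/
noncomputable def eval (f : LipZero M o) : StrongDual ℝ X :=
  (ContinuousLinearMap.apply ℝ ℝ f).comp P.ι.toContinuousLinearMap

theorem eval_apply (f : LipZero M o) (m : X) : P.eval f m = P.ι m f := rfl

/-- Every functional on the Lipschitz-free space is the evaluation at an element of `Lip₀(M)`, as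
the map `x ↦ ψ (δ x)` is Lipschitz. -/
theorem exists_eq_eval (ψ : StrongDual ℝ X) : ∃ g : LipZero M o, ψ = P.eval g := by
  have hlip : ∀ x y, |ψ (P.δ x) - ψ (P.δ y)| ≤ ‖ψ‖ * dist x y := by
    intro x y
    rw [← map_sub]
    exact (ψ.le_opNorm _).trans
      (mul_le_mul_of_nonneg_left (P.norm_δ_sub_le x y) (norm_nonneg _))
  refine ⟨ofLipschitz o (fun x => ψ (P.δ x))
    (exists_lipschitzWith_of_abs_sub_le (norm_nonneg _) hlip), ?_⟩
  refine ContinuousLinearMap.ext_on P.dense_span ?_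
  rintro _ ⟨x, rfl⟩
  rw [eval_apply, ι_apply_δ, ofLipschitz_apply, δ_base, map_zero, sub_zero]

theorem norm_eval_le (f : LipZero M o) : ‖P.eval f‖ ≤ ‖f‖ :=
  ContinuousLinearMap.opNorm_le_bound _ (norm_nonneg _) fun m => by
    rw [mul_comm]
    exact P.abs_ι_apply_le m f

/-- The norm of an operator on the Lipschitz-free space is determined by its values on the
molecules `(δ x - δ y) / d(x, y)`: by duality, since the closed convex hull of the molecules is
the unit ball. -/
theorem opNorm_le_of_forall_molecule (A : X →L[ℝ] X) {C : ℝ} (hC : 0 ≤ C)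
    (h : ∀ x y, ‖A (P.δ x - P.δ y)‖ ≤ C * dist x y) : ‖A‖ ≤ C := by
  refine ContinuousLinearMap.opNorm_le_bound _ hC fun m => ?_
  refine P.norm_le_of_forall _ (by positivity) fun f => ?_
  obtain ⟨g, hg⟩ := P.exists_eq_eval ((P.eval f).comp A)
  have hg' : ∀ m, P.ι (A m) f = P.ι m g := fun m => DFunLike.congr_fun hg m
  have hgn : ‖g‖ ≤ C * ‖f‖ := by
    refine LipZero.norm_le_of_forall _ (by positivity) fun x y => ?_
    rw [← P.ι_apply_δ_sub, ← hg']
    calc _ ≤ ‖A (P.δ x - P.δ y)‖ * ‖f‖ := P.abs_ι_apply_le _ f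
      _ ≤ C * dist x y * ‖f‖ := mul_le_mul_of_nonneg_right (h x y) (norm_nonneg _)
      _ = _ := by ring
  rw [hg']
  calc _ ≤ ‖m‖ * ‖g‖ := P.abs_ι_apply_le m g
    _ ≤ ‖m‖ * (C * ‖f‖) := mul_le_mul_of_nonneg_left hgn (norm_nonneg _)
    _ = _ := by ring

/-- The Daugavet property passes to the predual: the operator `m ↦ m(g) m₀` on the
Lipschitz-free space has the adjoint `f ↦ m₀(f) g` on `Lip₀(M)`. -/
theorem hasDaugavetProperty (P : FreePresentation M o X)
    (h : HasDaugavetProperty (LipZero M o)) : HasDaugavetProperty X := by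
  refine hasDaugavetProperty_of_forall_smulRight fun φ m₀ hφ hm₀ => ?_
  obtain ⟨g, rfl⟩ := P.exists_eq_eval φ
  have hm₀' : P.ι m₀ ≠ 0 := by
    rw [← norm_ne_zero_iff, P.ι.norm_map, norm_ne_zero_iff]
    exact hm₀
  have hg0 : g ≠ 0 := by
    rintro rfl
    exact hφ (ContinuousLinearMap.ext fun m => map_zero (P.ι m))
  have hD := h.norm_smulRight_add_id hm₀' hg0
  set A := (P.eval g).smulRight m₀ + ContinuousLinearMap.id ℝ X with hA
  have hle : ‖(P.ι m₀).smulRight g + ContinuousLinearMap.id ℝ (LipZero M o)‖ ≤ ‖A‖ := by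
    refine ContinuousLinearMap.opNorm_le_bound _ (norm_nonneg _) fun f => ?_
    refine LipZero.norm_le_of_forall _ (by positivity) fun x y => ?_
    have e : (P.ι m₀ f * g x + f x) - (P.ι m₀ f * g y + f y) = P.ι (A (P.δ x - P.δ y)) f := by
      simp only [hA, _root_.add_apply, ContinuousLinearMap.smulRight_apply, eval_apply,
        ContinuousLinearMap.id_apply, map_add, map_smul, _root_.smul_apply, ι_apply_δ_sub,
        smul_eq_mul]
      ring
    change |(P.ι m₀ f * g x + f x) - (P.ι m₀ f * g y + f y)| ≤ _
    rw [e]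
    calc _ ≤ ‖A (P.δ x - P.δ y)‖ * ‖f‖ := P.abs_ι_apply_le _ f
      _ ≤ ‖A‖ * dist x y * ‖f‖ := by
        refine mul_le_mul_of_nonneg_right ((A.le_opNorm _).trans ?_) (norm_nonneg _)
        exact mul_le_mul_of_nonneg_left (P.norm_δ_sub_le x y) (norm_nonneg _)
      _ = _ := by ring
  rw [hD, P.ι.norm_map] at hle
  have := mul_le_mul_of_nonneg_right (P.norm_eval_le g) (norm_nonneg m₀)
  linarith

end FreePresentation

end FreeSpace

/-! ### The Daugavet property of `Lip₀(M)` -/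

section LipschitzFunctions

open LipZero

variable {M : Type*} [MetricSpace M] {o : M}

theorem LipZero.exists_slope_gt (g : LipZero M o) {c : ℝ} (hc0 : 0 ≤ c) (hc : c < ‖g‖) :
    ∃ x y, 0 < dist x y ∧ c * dist x y ≤ g x - g y := by
  by_contra! h
  refine absurd (g.norm_le_of_forall hc0 fun x y => ?_) (not_le.2 hc)
  rcases eq_or_ne x y with rfl | hxy
  · simp
  have h1 := h x y (dist_pos.2 hxy)
  have h2 := h y x (dist_pos.2 hxy.symm)
  rw [dist_comm y x] at h2
  exact abs_le.2 ⟨by linarith, h1.le⟩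

/-- In the presence of almost geodesic curves, every function of `Lip₀(M)` almost attains its norm
at arbitrarily many well separated pairs of points that are arbitrarily close to each other,
relative to the separation.  The pairs lie on an almost geodesic curve that joins two points at
which the norm is almost attained: little is lost in total on this curve, hence little is lost on
each of its pieces. -/
theorem LipZero.exists_separated_steep_pairs [CompleteSpace M] (hM : HasApproxMidpoints M)
    {g : LipZero M o} (hg : g ≠ 0) {N : ℕ} (hN : 0 < N) {τ ε : ℝ} (hτ : 0 < τ) (hε : 0 < ε)
    (hε1 : ε ≤ 1) :
    ∃ (ρ : ℝ) (u v : ℕ → M), 0 < ρ ∧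
      (∀ i < N, 0 < dist (u i) (v i) ∧ dist (u i) (v i) ≤ τ * ρ ∧
        (1 - ε) * ‖g‖ * dist (u i) (v i) ≤ g (u i) - g (v i)) ∧
      ∀ i < N, ∀ j < N, i ≠ j → 2 * ρ ≤ dist (u i) (u j) := by
  have hgn : 0 < ‖g‖ := norm_pos_iff.2 hg
  have hN0 : (0 : ℝ) < N := Nat.cast_pos.2 hN
  have hN1 : (1 : ℝ) ≤ N := Nat.one_le_cast.2 hN
  -- `h` is the time between the points of a pair, `η` the relative loss on the whole curve
  set h : ℝ := min (τ / (8 * N)) (1 / N) with hh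
  have hh0 : 0 < h := lt_min (by positivity) (by positivity)
  have hhτ : h ≤ τ / (8 * N) := min_le_left _ _
  have hhN : h ≤ 1 / N := min_le_right _ _
  have hN1' : 1 / (N : ℝ) ≤ 1 := (div_le_one hN0).2 hN1
  set η : ℝ := min (ε * h / 4) (1 / (2 * N)) with hη
  have hη0 : 0 < η := lt_min (by positivity) (by positivity)
  have hηε : η ≤ ε * h / 4 := min_le_left _ _
  have hηN : η ≤ 1 / N / 2 := (min_le_right _ _).trans_eq (by rw [mul_comm, div_div])
  have hηh : η ≤ h / 4 := hηε.trans (by nlinarith)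
  obtain ⟨x, y, hxy, hslope⟩ := g.exists_slope_gt (c := (1 - η) * ‖g‖)
    (mul_nonneg (by linarith) hgn.le) (by nlinarith)
  obtain ⟨G, hG0, hG1, hG⟩ := hM.exists_lipschitz_curve x y hη0
  set D := dist x y with hD
  have hGlow : ∀ s t, 0 ≤ s → s ≤ t → t ≤ 1 → D * (t - s - η) ≤ dist (G s) (G t) := by
    intro s t hs hst ht
    have h1 := hG 0 s le_rfl hs (hst.trans ht)
    have h2 := hG t 1 (hs.trans hst) ht le_rfl
    rw [hG0] at h1
    rw [hG1] at h2
    have h3 := dist_triangle4 x (G s) (G t) y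
    have h4 : 0 ≤ η * D * (t - s) := mul_nonneg (by positivity) (by linarith)
    rw [← hD] at h3
    linarith
  have hgG : ∀ s t, 0 ≤ s → s ≤ t → t ≤ 1 → ‖g‖ * D * (t - s - 2 * η) ≤ g (G s) - g (G t) := by
    intro s t hs hst ht
    have h1 := hG 0 s le_rfl hs (hst.trans ht)
    have h2 := hG t 1 (hs.trans hst) ht le_rfl
    rw [hG0] at h1
    rw [hG1] at h2
    have h3 := (abs_le.1 ((g.abs_sub_le x (G s)).trans
      (mul_le_mul_of_nonneg_left h1 hgn.le))).2
    have h4 := (abs_le.1 ((g.abs_sub_le (G t) y).trans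
      (mul_le_mul_of_nonneg_left h2 hgn.le))).2
    have h5 : 0 ≤ ‖g‖ * D * η * (t - s) := mul_nonneg (by positivity) (by linarith)
    linarith
  have hiN : ∀ i < N, (i : ℝ) / N + 1 / N ≤ 1 := by
    intro i hi
    rw [← add_div, div_le_one hN0]
    exact_mod_cast hi
  refine ⟨D / (4 * N), fun i => G (i / N), fun i => G (i / N + h), by positivity, ?_, ?_⟩
  · intro i hi
    have hi0 : (0 : ℝ) ≤ i / N := by positivity
    have hi1 : (i : ℝ) / N + h ≤ 1 := by linarith [hiN i hi]
    have h1 := hGlow (i / N) (i / N + h) hi0 (by linarith) hi1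
    have h2 := hG (i / N) (i / N + h) hi0 (by linarith) hi1
    have h3 := hgG (i / N) (i / N + h) hi0 (by linarith) hi1
    rw [add_sub_cancel_left] at h1 h2 h3
    refine ⟨lt_of_lt_of_le (mul_pos hxy (by linarith)) h1, ?_, ?_⟩
    · calc _ ≤ (1 + η) * D * h := h2
        _ ≤ 2 * D * (τ / (8 * N)) := by
          have : η ≤ 1 := by linarith
          gcongr
          linarith
        _ = _ := by field_simp; norm_num
    · calc _ ≤ (1 - ε) * ‖g‖ * ((1 + η) * D * h) :=
            mul_le_mul_of_nonneg_left h2 (mul_nonneg (by linarith) hgn.le)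
        _ = ‖g‖ * D * ((1 - ε) * (1 + η) * h) := by ring
        _ ≤ ‖g‖ * D * (h - 2 * η) := by
          refine mul_le_mul_of_nonneg_left ?_ (by positivity)
          have e1 : 0 ≤ ε * η * h := by positivity
          have e2 : η * h ≤ η * 1 := mul_le_mul_of_nonneg_left (by linarith) hη0.le
          nlinarith
        _ ≤ _ := h3
  · have key : ∀ i j : ℕ, i < j → j < N → 2 * (D / (4 * N)) ≤ dist (G (i / N)) (G (j / N)) := by
      intro i j hij hj
      have hij' : (i : ℝ) / N + 1 / N ≤ j / N := by
        rw [← add_div]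
        exact div_le_div_of_nonneg_right (by exact_mod_cast hij) hN0.le
      have h1 := hGlow (i / N) (j / N) (by positivity) (by linarith [one_div_pos.2 hN0])
        (by linarith [hiN j hj, one_div_pos.2 hN0])
      refine le_trans ?_ h1
      calc 2 * (D / (4 * N)) = D * (1 / N / 2) := by field_simp; norm_num
        _ ≤ _ := mul_le_mul_of_nonneg_left (by linarith) hxy.le
    intro i hi j hj hij
    rcases lt_or_gt_of_ne hij with h | h
    · exact key i j h hj
    · rw [dist_comm]
      exact key j i h hi

/-- A `1`-Lipschitz function can be changed inside a ball so that it gets slope `1` between two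
points near the centre, at the expense of a Lipschitz constant slightly larger than `1`. -/
theorem exists_steep_modification {f : M → ℝ} (hf : ∀ x y, |f x - f y| ≤ dist x y) {u v : M}
    {ρ ε : ℝ} (hε : 0 < ε) (huv : 0 < dist u v)
    (hρ : (2 + ε) * dist u v ≤ ε * ρ) :
    ∃ F : M → ℝ, (∀ x y, |F x - F y| ≤ (1 + ε) * dist x y) ∧ F u - F v = dist u v ∧
      ∀ x, ρ ≤ dist x u → F x = f x := by
  classical
  have hρ1 : dist u v < ρ := by nlinarith
  have huv' : u ≠ v := dist_pos.1 huv
  set s : Set M := insert v (insert u {x | ρ ≤ dist x u}) with hs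
  set k : M → ℝ := fun x => if x = v then f u - dist u v else f x with hk
  have hkv : k v = f u - dist u v := if_pos rfl
  have hkne : ∀ x, x ≠ v → k x = f x := fun x hx => if_neg hx
  have key : ∀ x ∈ s, x ≠ v → |k x - k v| ≤ (1 + ε) * dist x v := by
    intro x hx hxv
    rw [hkv, hkne x hxv]
    rcases hx with hx | rfl | hx
    · exact absurd hx hxv
    · rw [sub_sub_cancel, abs_of_pos huv]
      nlinarith
    · have hx : ρ ≤ dist x u := hx
      have h1 := abs_le.1 (hf x u)
      have h2 := dist_triangle x v u
      rw [dist_comm v u] at h2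
      have h3 : 2 * dist u v ≤ ε * dist x v := by nlinarith
      have h4 := dist_triangle x u v
      exact abs_le.2 ⟨by nlinarith, by nlinarith⟩
  have hlip : LipschitzOnWith ⟨1 + ε, by linarith⟩ k s := by
    refine LipschitzOnWith.of_dist_le_mul fun x hx y hy => ?_
    rw [Real.dist_eq]
    change _ ≤ (1 + ε) * dist x y
    by_cases hxv : x = v
    · by_cases hyv : y = v
      · simp [hxv, hyv]
      · rw [hxv, abs_sub_comm, dist_comm]
        exact key y hy hyv
    · by_cases hyv : y = v
      · rw [hyv]
        exact key x hx hxv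
      · rw [hkne x hxv, hkne y hyv]
        have := hf x y
        have : 0 ≤ ε * dist x y := by positivity
        linarith
  obtain ⟨F, hF, hFk⟩ := hlip.extend_real
  refine ⟨F, fun x y => (Real.dist_eq _ _).symm.le.trans (hF.dist_le_mul x y), ?_, fun x hx => ?_⟩
  · rw [← hFk (Set.mem_insert v _), ← hFk (Set.mem_insert_of_mem _ (Set.mem_insert u _)), hkv,
      hkne u huv', sub_sub_cancel]
  · have hxv : x ≠ v := by
      rintro rfl
      rw [dist_comm] at hx
      linarith
    rw [← hFk (Set.mem_insert_of_mem _ (Set.mem_insert_of_mem _ hx)), hkne x hxv]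

/-- At each of two points at most one of the functions `h i` is nonzero, so that at most two
summands contribute. -/
theorem sum_abs_sub_le_of_disjoint_support {ι : Type*} (s : Finset ι) {h : ι → M → ℝ} {K : ℝ}
    (hK : 0 ≤ K) (hlip : ∀ i ∈ s, ∀ x y, |h i x - h i y| ≤ K * dist x y)
    (hdisj : ∀ i ∈ s, ∀ j ∈ s, i ≠ j → ∀ x, h i x = 0 ∨ h j x = 0) (x y : M) :
    ∑ i ∈ s, |h i x - h i y| ≤ 2 * K * dist x y := by
  classical
  have hcard : ∀ z, (s.filter fun i => h i z ≠ 0).card ≤ 1 := by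
    intro z
    refine Finset.card_le_one.2 fun i hi j hj => ?_
    rw [Finset.mem_filter] at hi hj
    by_contra hij
    exact (hdisj i hi.1 j hj.1 hij z).elim hi.2 hj.2
  have hsub : ∀ i ∈ s, |h i x - h i y| ≠ 0 → h i x ≠ 0 ∨ h i y ≠ 0 := by
    intro i _ hi
    by_contra! h0
    exact hi (by simp [h0.1, h0.2])
  rw [← Finset.sum_filter_of_ne hsub, Finset.filter_or]
  refine (Finset.sum_le_card_nsmul _ _ (K * dist x y) fun i hi => hlip i ?_ x y).trans ?_
  · rcases Finset.mem_union.1 hi with hi | hi <;> exact (Finset.mem_filter.1 hi).1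
  · rw [nsmul_eq_mul, mul_assoc]
    refine mul_le_mul_of_nonneg_right ?_ (mul_nonneg hK dist_nonneg)
    exact_mod_cast (Finset.card_union_le _ _).trans (add_le_add (hcard x) (hcard y))

/-- A bounded functional is small on one of many Lipschitz functions with disjoint supports. -/
theorem exists_abs_dual_apply_le {N : ℕ} (hN : 0 < N) {h : ℕ → M → ℝ} {K : ℝ} (hK : 0 ≤ K)
    (hlip : ∀ i < N, ∀ x y, |h i x - h i y| ≤ K * dist x y)
    (hdisj : ∀ i < N, ∀ j < N, i ≠ j → ∀ x, h i x = 0 ∨ h j x = 0)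
    (φ : StrongDual ℝ (LipZero M o)) {H : ℕ → LipZero M o}
    (hH : ∀ i < N, ∀ x, H i x = h i x - h i o) :
    ∃ i < N, N * |φ (H i)| ≤ ‖φ‖ * (2 * K) := by
  set c : ℕ → ℝ := fun i => (SignType.sign (φ (H i)) : ℝ) with hc
  have hc1 : ∀ i, |c i| ≤ 1 := by
    intro i
    simp only [hc]
    rcases SignType.sign (φ (H i)) with _ | _ | _ <;> simp
  set S : LipZero M o := ∑ i ∈ Finset.range N, c i • H i with hS
  have hSn : ‖S‖ ≤ 2 * K := by
    refine norm_le_of_forall _ (by positivity) fun x y => ?_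
    have e : S x - S y = ∑ i ∈ Finset.range N, c i * (h i x - h i y) := by
      rw [hS, LipZero.sum_apply, LipZero.sum_apply, ← Finset.sum_sub_distrib]
      refine Finset.sum_congr rfl fun i hi => ?_
      rw [LipZero.smul_apply, LipZero.smul_apply, hH i (Finset.mem_range.1 hi),
        hH i (Finset.mem_range.1 hi)]
      ring
    rw [e]
    refine (Finset.abs_sum_le_sum_abs _ _).trans (le_trans (Finset.sum_le_sum fun i _ => ?_)
      (sum_abs_sub_le_of_disjoint_support (Finset.range N) hK
        (fun i hi => hlip i (Finset.mem_range.1 hi))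
        (fun i hi j hj => hdisj i (Finset.mem_range.1 hi) j (Finset.mem_range.1 hj)) x y))
    rw [abs_mul]
    exact mul_le_of_le_one_left (abs_nonneg _) (hc1 i)
  have hφS : φ S = ∑ i ∈ Finset.range N, |φ (H i)| := by
    rw [hS, map_sum]
    refine Finset.sum_congr rfl fun i _ => ?_
    rw [map_smul, smul_eq_mul, hc, sign_mul_self]
  have hle : ∑ i ∈ Finset.range N, |φ (H i)| ≤ ‖φ‖ * (2 * K) := by
    rw [← hφS]
    exact (le_abs_self _).trans ((φ.le_opNorm S).trans
      (mul_le_mul_of_nonneg_left hSn (norm_nonneg _)))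
  by_contra! hlt
  have hsum : ∑ i ∈ Finset.range N, ‖φ‖ * (2 * K) < ∑ i ∈ Finset.range N, N * |φ (H i)| :=
    Finset.sum_lt_sum_of_nonempty (Finset.nonempty_range_iff.2 hN.ne')
      fun i hi => hlt i (Finset.mem_range.1 hi)
  rw [Finset.sum_const, Finset.card_range, nsmul_eq_mul, ← Finset.mul_sum] at hsum
  exact absurd (lt_of_mul_lt_mul_left hsum (Nat.cast_nonneg _)) (not_lt.2 hle)

/-- The quantitative form of the Daugavet equation: for a function `f` that almost attains the
norm of `φ` and suitable points `u`, `v` at which `g` almost attains its norm, a modification of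
`f` with slope `1` at `(u, v)` on which `φ` is almost unchanged shows that the norm of
`I + φ ⊗ g` is large. -/
theorem one_add_le_of_hasApproxMidpoints [CompleteSpace M] (hM : HasApproxMidpoints M)
    {φ : StrongDual ℝ (LipZero M o)} {g : LipZero M o} (hg : g ≠ 0) {ε : ℝ} (hε : 0 < ε)
    (hε1 : ε ≤ 1) (hεφ : 2 * ε ≤ ‖φ‖) :
    1 + (‖φ‖ - 2 * ε) * ((1 - ε) * ‖g‖) ≤
      ‖φ.smulRight g + ContinuousLinearMap.id ℝ (LipZero M o)‖ * (1 + ε) := by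
  obtain ⟨f, hf1, hφf⟩ : ∃ f : LipZero M o, ‖f‖ < 1 ∧ ‖φ‖ - ε < φ f := by
    obtain ⟨f, hf1, hf⟩ := φ.exists_lt_apply_of_lt_opNorm (r := ‖φ‖ - ε) (by linarith)
    rcases lt_abs.1 hf with hf | hf
    · exact ⟨f, hf1, hf⟩
    · exact ⟨-f, by rwa [norm_neg], by rwa [map_neg]⟩
  have hf : ∀ x y, |f x - f y| ≤ dist x y := fun x y =>
    (f.abs_sub_le x y).trans (mul_le_of_le_one_left dist_nonneg hf1.le)
  obtain ⟨N, hN⟩ := exists_nat_ge (‖φ‖ * (2 * 3) / ε + 1)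
  have hN0 : 0 < N := by
    have : (0 : ℝ) < N := lt_of_lt_of_le (by positivity) hN
    exact_mod_cast this
  obtain ⟨ρ, u, v, hρ, huv, hsep⟩ := exists_separated_steep_pairs hM hg hN0
    (τ := ε / (2 + ε)) (by positivity) hε hε1
  have hmod : ∀ i, ∃ F : M → ℝ, i < N → (∀ x y, |F x - F y| ≤ (1 + ε) * dist x y) ∧
      F (u i) - F (v i) = dist (u i) (v i) ∧ ∀ x, ρ ≤ dist x (u i) → F x = f x := by
    intro i
    by_cases hi : i < N
    · obtain ⟨h1, h2, -⟩ := huv i hi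
      have h3 : (2 + ε) * dist (u i) (v i) ≤ ε * ρ := by
        rw [div_mul_eq_mul_div, le_div_iff₀ (by positivity)] at h2
        linarith
      obtain ⟨F, hF⟩ := exists_steep_modification hf hε h1 h3
      exact ⟨F, fun _ => hF⟩
    · exact ⟨0, fun h => absurd h hi⟩
  choose F hF using hmod
  have hlip : ∀ i < N, ∀ x y, |(F i x - f x) - (F i y - f y)| ≤ 3 * dist x y := by
    intro i hi x y
    have h1 := abs_le.1 ((hF i hi).1 x y)
    have h2 := abs_le.1 (hf x y)
    have h3 : ε * dist x y ≤ 1 * dist x y := mul_le_mul_of_nonneg_right hε1 dist_nonneg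
    exact abs_le.2 ⟨by linarith, by linarith⟩
  have hH : ∀ i, ∃ H : LipZero M o, i < N → ∀ x, H x = (F i x - f x) - (F i o - f o) := by
    intro i
    by_cases hi : i < N
    · exact ⟨ofLipschitz o (fun x => F i x - f x)
        (exists_lipschitzWith_of_abs_sub_le (by norm_num) (hlip i hi)), fun _ x => rfl⟩
    · exact ⟨0, fun h => absurd h hi⟩
  choose H hH using hH
  have hdisj : ∀ i < N, ∀ j < N, i ≠ j → ∀ x, F i x - f x = 0 ∨ F j x - f x = 0 := by
    intro i hi j hj hij x
    by_contra! h0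
    have h1 : dist x (u i) < ρ := by
      by_contra! h
      exact h0.1 (sub_eq_zero.2 ((hF i hi).2.2 x h))
    have h2 : dist x (u j) < ρ := by
      by_contra! h
      exact h0.2 (sub_eq_zero.2 ((hF j hj).2.2 x h))
    have h3 := dist_triangle_left (u i) (u j) x
    linarith [hsep i hi j hj hij]
  obtain ⟨i, hi, hφi⟩ := exists_abs_dual_apply_le hN0 (by norm_num) hlip hdisj φ hH
  have hφH : |φ (H i)| ≤ ε := by
    have h1 : ‖φ‖ * (2 * 3) ≤ ε * N := by
      rw [← div_le_iff₀' hε]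
      linarith
    have h2 : (N : ℝ) * |φ (H i)| ≤ N * ε := hφi.trans (h1.trans_eq (mul_comm _ _))
    exact le_of_mul_le_mul_left h2 (Nat.cast_pos.2 hN0)
  set k : LipZero M o := f + H i with hk
  have hksub : ∀ x y, k x - k y = F i x - F i y := by
    intro x y
    rw [hk, LipZero.add_apply, LipZero.add_apply, hH i hi, hH i hi]
    ring
  have hkn : ‖k‖ ≤ 1 + ε := norm_le_of_forall _ (by positivity) fun x y => by
    rw [hksub]
    exact (hF i hi).1 x y
  have hφk : ‖φ‖ - 2 * ε ≤ φ k := by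
    rw [hk, map_add]
    linarith [(abs_le.1 hφH).1]
  set T := φ.smulRight g + ContinuousLinearMap.id ℝ (LipZero M o) with hT
  obtain ⟨hd, -, hsteep⟩ := huv i hi
  have hTk : T k (u i) - T k (v i) = φ k * (g (u i) - g (v i)) + dist (u i) (v i) := by
    rw [← (hF i hi).2.1, ← hksub]
    change (φ k * g (u i) + k (u i)) - (φ k * g (v i) + k (v i)) = _
    ring
  have hup : T k (u i) - T k (v i) ≤ ‖T‖ * (1 + ε) * dist (u i) (v i) :=
    (le_abs_self _).trans (((T k).abs_sub_le _ _).trans (mul_le_mul_of_nonneg_right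
      ((T.le_opNorm k).trans (mul_le_mul_of_nonneg_left hkn (norm_nonneg _))) dist_nonneg))
  have hlow : (‖φ‖ - 2 * ε) * ((1 - ε) * ‖g‖ * dist (u i) (v i)) ≤
      φ k * (g (u i) - g (v i)) := by
    refine mul_le_mul hφk hsteep ?_ (by linarith)
    exact mul_nonneg (mul_nonneg (by linarith) (norm_nonneg _)) hd.le
  refine le_of_mul_le_mul_right ?_ hd
  linarith

theorem HasApproxMidpoints.hasDaugavetProperty_lipZero [CompleteSpace M]
    (hM : HasApproxMidpoints M) : HasDaugavetProperty (LipZero M o) := by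
  refine hasDaugavetProperty_of_forall_smulRight fun φ g hφ hg => ?_
  have hφ0 : 0 < ‖φ‖ := norm_pos_iff.2 hφ
  set T := φ.smulRight g + ContinuousLinearMap.id ℝ (LipZero M o)
  have h1 : Tendsto (fun ε : ℝ => 1 + (‖φ‖ - 2 * ε) * ((1 - ε) * ‖g‖)) (𝓝[>] 0)
      (𝓝 (1 + (‖φ‖ - 2 * 0) * ((1 - 0) * ‖g‖))) :=
    (Continuous.tendsto (by fun_prop) 0).mono_left nhdsWithin_le_nhds
  have h2 : Tendsto (fun ε : ℝ => ‖T‖ * (1 + ε)) (𝓝[>] 0) (𝓝 (‖T‖ * (1 + 0))) :=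
    (Continuous.tendsto (by fun_prop) 0).mono_left nhdsWithin_le_nhds
  have h3 := le_of_tendsto_of_tendsto h1 h2 (by
    filter_upwards [Ioo_mem_nhdsGT (lt_min one_pos (half_pos hφ0))] with ε hε
    have hε' := lt_min_iff.1 hε.2
    exact one_add_le_of_hasApproxMidpoints hM hg hε.1 hε'.1.le (by linarith [hε'.2]))
  simpa using h3

end LipschitzFunctions

/-! ### Approximate midpoints from the Daugavet property -/

section Midpoints

open LipZero

variable {M : Type*} [MetricSpace M] {o : M}

/-- The difference of the two peaks of height `r` and slope `1 / (1 + α)` at `x` and at `y`. -/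
noncomputable def peakDiff (x y : M) (r α : ℝ) (t : M) : ℝ :=
  max (r - dist x t / (1 + α)) 0 - max (r - dist t y / (1 + α)) 0

theorem peakDiff_sub_of_steep {x y : M} {r α δ : ℝ} (hα : 0 < α) (hαδ : α ≤ δ) (hr : 0 < r)
    (hno : ∀ z, dist x z ≤ (1 + δ) * r → (1 + δ) * r < dist z y) {t s : M}
    (hts : dist t s < (1 + α) * (peakDiff x y r α t - peakDiff x y r α s)) :
    (δ - α) * r ≤ dist t s ∧ (1 + α) * (peakDiff x y r α t - peakDiff x y r α s) =
      2 * (1 + α) * r - (dist x t + dist s y) := by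
  have hα1 : 0 < 1 + α := by linarith
  have hscale : ∀ a, (1 + α) * max (r - a / (1 + α)) 0 = max ((1 + α) * r - a) 0 := by
    intro a
    rw [mul_max_of_nonneg _ _ hα1.le, mul_zero, mul_sub, mul_div_cancel₀ _ hα1.ne']
  have hαr : α * r ≤ δ * r := mul_le_mul_of_nonneg_right hαδ hr.le
  simp only [peakDiff, mul_sub, hscale] at hts ⊢
  set R := r * 1 + α * r with hR
  have hRe : (1 + α) * r = R := by ring
  simp only [hRe] at hts ⊢
  have h1 := dist_triangle x t s
  have h2 := dist_triangle x s t
  have h3 := dist_triangle t s y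
  have h4 := dist_triangle s t y
  rw [dist_comm s t] at h2 h4
  have hnot := hno t
  have hnos := hno s
  -- `t` lies in the support of the first peak and `s` in that of the second one
  have hp : dist x t < R := by
    by_contra! hp
    rw [max_eq_right (by linarith : R - dist x t ≤ 0)] at hts
    have := le_max_right (R - dist x s) 0
    have : max (R - dist s y) 0 ≤ max (R - dist t y) 0 + dist t s :=
      max_le (by linarith [le_max_left (R - dist t y) 0])
        (add_nonneg (le_max_right _ _) dist_nonneg)
    linarith
  have hq : dist s y < R := by
    by_contra! hq
    rw [max_eq_right (by linarith : R - dist s y ≤ 0)] at hts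
    have := le_max_right (R - dist t y) 0
    have : max (R - dist x t) 0 ≤ max (R - dist x s) 0 + dist t s :=
      max_le (by linarith [le_max_left (R - dist x s) 0])
        (add_nonneg (le_max_right _ _) dist_nonneg)
    linarith
  have hty : (1 + δ) * r < dist t y := hno t (by linarith)
  have hxs : R ≤ dist x s := by
    by_contra! h
    have := hno s (by linarith)
    linarith
  rw [max_eq_left (by linarith : 0 ≤ R - dist x t), max_eq_left (by linarith : 0 ≤ R - dist s y),
    max_eq_right (by linarith : R - dist t y ≤ 0), max_eq_right (by linarith : R - dist x s ≤ 0)]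
  constructor <;> linarith

/-- If `x` and `y` have no approximate midpoint, the difference of the peaks is almost
`1`-Lipschitz: a pair of points with slope more than `1 / (1 + α)` has one point in each of the
supports, and these are at positive distance. -/
theorem peakDiff_sub_le {x y : M} {r α δ η : ℝ} (hα : 0 < α) (hαδ : α ≤ δ) (hr : 0 < r)
    (hη : 0 ≤ η) (hαη : 2 * α ≤ η * (δ - α)) (hxy : dist x y = 2 * r)
    (hno : ∀ z, dist x z ≤ (1 + δ) * r → (1 + δ) * r < dist z y) (t s : M) :
    peakDiff x y r α t - peakDiff x y r α s ≤ (1 + η) * dist t s := by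
  have hd := dist_nonneg (x := t) (y := s)
  rcases lt_or_ge (dist t s) ((1 + α) * (peakDiff x y r α t - peakDiff x y r α s)) with h | h
  · obtain ⟨h1, h2⟩ := peakDiff_sub_of_steep hα hαδ hr hno h
    set E := peakDiff x y r α t - peakDiff x y r α s
    have h3 := dist_triangle4 x t s y
    have h4 : 2 * α * r ≤ η * dist t s := calc
      _ ≤ η * (δ - α) * r := mul_le_mul_of_nonneg_right hαη hr.le
      _ = η * ((δ - α) * r) := by ring
      _ ≤ _ := mul_le_mul_of_nonneg_left h1 hη
    have hE : 0 ≤ E := by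
      have : 0 < (1 + α) * E := hd.trans_lt h
      exact (pos_of_mul_pos_right this (by linarith)).le
    have := mul_nonneg hα.le hE
    linarith
  · have := mul_nonneg hη hd
    by_contra! hlt
    set E := peakDiff x y r α t - peakDiff x y r α s
    have hE : 0 ≤ E := by linarith
    have := mul_nonneg hα.le hE
    linarith

/-- The Daugavet equation for the operator `f ⊗ m`, where `m` is the molecule
`(δ y - δ x) / d(x, y)` and `f` has slope `1` at `(x, y)`, provides a molecule `m'` of points `t`
and `s` with `‖m' + f(m') m‖ > 2 - ε`; the norm is witnessed by the `1`-Lipschitz function `k`, and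
the inequality is multiplied by the distances. -/
theorem FreePresentation.exists_molecule {X : Type*} [NormedAddCommGroup X] [NormedSpace ℝ X]
    (P : FreePresentation M o X) (hX : HasDaugavetProperty X) {x y : M} (hxy : x ≠ y)
    {f : LipZero M o} (hf : f x - f y = dist x y) {ε : ℝ} (hε : 0 < ε) (hε1 : ε ≤ 1) :
    ∃ (t s : M) (k : M → ℝ), (∀ a b, k a - k b ≤ dist a b) ∧ 0 ≤ f t - f s ∧
      (2 - ε) * dist t s * dist x y <
        (f t - f s) * (k y - k x) + (k t - k s) * dist x y := by
  have hd : 0 < dist x y := dist_pos.2 hxy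
  set w : X := (dist x y)⁻¹ • (P.δ y - P.δ x) with hw
  have hwι : ∀ h, P.ι w h = (dist x y)⁻¹ * (h y - h x) := fun h => by
    rw [hw, map_smul, _root_.smul_apply, P.ι_apply_δ_sub, smul_eq_mul]
  have hw1 : 1 ≤ ‖w‖ := by
    have hlip : ∀ a b, |dist x a - dist x b| ≤ 1 * dist a b := fun a b => by
      rw [one_mul, dist_comm x a, dist_comm x b]
      exact abs_dist_sub_le a b x
    set h : LipZero M o := ofLipschitz o (dist x)
      (exists_lipschitzWith_of_abs_sub_le zero_le_one hlip) with hh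
    have hn : ‖h‖ ≤ 1 := LipZero.norm_le_of_forall _ zero_le_one fun a b => by
      rw [hh, ofLipschitz_apply, ofLipschitz_apply, sub_sub_sub_cancel_right]
      exact hlip a b
    have h1 := (le_abs_self _).trans (P.abs_ι_apply_le w h)
    rw [hwι, hh, ofLipschitz_apply, ofLipschitz_apply, sub_sub_sub_cancel_right, dist_self,
      sub_zero, inv_mul_cancel₀ hd.ne'] at h1
    exact h1.trans (mul_le_of_le_one_right (norm_nonneg _) hn)
  have hf1 : 1 ≤ ‖P.eval f‖ := by
    have h1 := (le_abs_self _).trans ((P.eval f).le_opNorm (P.δ x - P.δ y))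
    rw [P.eval_apply, P.ι_apply_δ_sub, hf] at h1
    have h2 := h1.trans (mul_le_mul_of_nonneg_left (P.norm_δ_sub_le x y) (norm_nonneg _))
    exact (le_mul_iff_one_le_left hd).1 h2
  have hD := hX.norm_smulRight_add_id (φ := P.eval f) (g := w)
    (norm_pos_iff.1 (by linarith)) (norm_pos_iff.1 (by linarith))
  set A := (P.eval f).smulRight w + ContinuousLinearMap.id ℝ X with hA
  have hA2 : 2 ≤ ‖A‖ := by nlinarith
  obtain ⟨t, s, hts⟩ : ∃ t s, (2 - ε) * dist t s < ‖A (P.δ t - P.δ s)‖ := by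
    by_contra! h
    linarith [P.opNorm_le_of_forall_molecule A (by linarith) h]
  obtain ⟨h, hh⟩ : ∃ h, (2 - ε) * dist t s * ‖h‖ < |P.ι (A (P.δ t - P.δ s)) h| := by
    by_contra! h
    exact absurd (P.norm_le_of_forall _ (mul_nonneg (by linarith) dist_nonneg) h) (not_le.2 hts)
  have hAι : P.ι (A (P.δ t - P.δ s)) h * dist x y =
      (f t - f s) * (h y - h x) + (h t - h s) * dist x y := by
    have e : P.ι (A (P.δ t - P.δ s)) h =
        (f t - f s) * ((dist x y)⁻¹ * (h y - h x)) + (h t - h s) := by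
      rw [hA, _root_.add_apply, ContinuousLinearMap.smulRight_apply, ContinuousLinearMap.id_apply,
        map_add, _root_.add_apply, map_smul, _root_.smul_apply, hwι, P.ι_apply_δ_sub,
        P.eval_apply, P.ι_apply_δ_sub, smul_eq_mul]
    rw [e]
    field_simp
  have hn : 0 < ‖h‖ := by
    refine norm_pos_iff.2 ?_
    rintro rfl
    simp at hh
  set k : M → ℝ := fun a => ‖h‖⁻¹ * h a with hk
  have hklip : ∀ a b, k a - k b ≤ dist a b := fun a b => by
    rw [hk, ← mul_sub, inv_mul_le_iff₀ hn]
    exact (le_abs_self _).trans (h.abs_sub_le a b)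
  have hkA : (2 - ε) * dist t s * dist x y <
      |(f t - f s) * (k y - k x) + (k t - k s) * dist x y| := by
    have e : (f t - f s) * (k y - k x) + (k t - k s) * dist x y =
        ‖h‖⁻¹ * (P.ι (A (P.δ t - P.δ s)) h * dist x y) := by
      rw [hAι, hk]
      ring
    rw [e, abs_mul, abs_mul, abs_of_pos hd, abs_of_pos (inv_pos.2 hn), ← mul_assoc]
    refine mul_lt_mul_of_pos_right ?_ hd
    rwa [lt_inv_mul_iff₀ hn, mul_comm ‖h‖]
  have hklip' : ∀ a b, -k a - -k b ≤ dist a b := fun a b => by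
    have := hklip b a
    rw [dist_comm] at this
    linarith
  -- exchanging `t` and `s` and changing the sign of `k` fixes both signs
  rcases le_total 0 (f t - f s) with hE | hE <;> rcases lt_abs.1 hkA with hs | hs
  · exact ⟨t, s, k, hklip, hE, hs⟩
  · exact ⟨t, s, fun a => -k a, hklip', hE, by linarith⟩
  · exact ⟨s, t, fun a => -k a, hklip', by linarith, by rw [dist_comm s t]; linarith⟩
  · exact ⟨s, t, k, hklip, by linarith, by rw [dist_comm s t]; linarith⟩

theorem FreePresentation.hasApproxMidpoints {X : Type*} [NormedAddCommGroup X] [NormedSpace ℝ X]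
    (P : FreePresentation M o X) (hX : HasDaugavetProperty X) : HasApproxMidpoints M := by
  intro x y δ' hδ'
  by_contra! hno'
  rcases eq_or_ne x y with rfl | hxy
  · have := hno' x
    simp at this
  have hd : 0 < dist x y := dist_pos.2 hxy
  set r := dist x y / 2 with hrdef
  have hr : 0 < r := half_pos hd
  have hxyr : dist x y = 2 * r := by rw [hrdef]; ring
  set δ := min δ' 1 with hδ
  have hδ0 : 0 < δ := lt_min hδ' one_pos
  have hδ1 : δ ≤ 1 := min_le_right _ _
  have hno : ∀ z, dist x z ≤ (1 + δ) * r → (1 + δ) * r < dist z y := by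
    intro z hz
    have hle : (1 + δ) * r ≤ (1 + δ') * r :=
      mul_le_mul_of_nonneg_right (by linarith [min_le_left δ' 1]) hr.le
    exact hle.trans_lt (hno' z (hz.trans hle))
  -- `α` is of smaller order than `δ`, and `η` is chosen with `2 α = η (δ - δ / 16)`
  set α := δ ^ 2 / 16 with hα
  set η := 2 * δ / 15 with hη
  have hα0 : 0 < α := by positivity
  have hη0 : 0 < η := by positivity
  have hαδ16 : α ≤ δ / 16 := by rw [hα]; nlinarith
  have hαδ : α ≤ δ := by linarith
  have hαη : 2 * α ≤ η * (δ - α) := by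
    have : η * (15 * δ / 16) ≤ η * (δ - α) := mul_le_mul_of_nonneg_left (by linarith) hη0.le
    refine le_trans (le_of_eq ?_) this
    rw [hα, hη]
    ring
  have hup := peakDiff_sub_le hα0 hαδ hr hη0.le hαη hxyr hno
  have hlip : ∀ t s, |peakDiff x y r α t - peakDiff x y r α s| ≤ (1 + η) * dist t s := by
    intro t s
    have := hup s t
    rw [dist_comm] at this
    exact abs_le.2 ⟨by linarith, hup t s⟩
  set f : LipZero M o := ofLipschitz o (peakDiff x y r α)
    (exists_lipschitzWith_of_abs_sub_le (by linarith) hlip) with hf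
  have hfsub : ∀ a b, f a - f b = peakDiff x y r α a - peakDiff x y r α b := fun a b => by
    rw [hf, ofLipschitz_apply, ofLipschitz_apply, sub_sub_sub_cancel_right]
  have hfxy : f x - f y = dist x y := by
    have h1 : r - 2 * r / (1 + α) ≤ 0 := by
      rw [sub_nonpos, le_div_iff₀ (by linarith)]
      nlinarith
    rw [hfsub, peakDiff, peakDiff, dist_self, dist_self, hxyr, zero_div, sub_zero,
      max_eq_right h1, max_eq_left hr.le]
    ring
  -- with `ε = α / (1 + α)`, slopes above `1 - ε` are those that exceed the slope of the peaks
  set ε := α / (1 + α) with hε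
  have hε0 : 0 < ε := by positivity
  have hεα : ε ≤ α := div_le_self hα0.le (by linarith)
  have hε1 : (1 + α) * (1 - ε) = 1 := by
    rw [hε]
    field_simp
    ring
  obtain ⟨t, s, k, hk, hE, hlt⟩ := P.exists_molecule hX hxy hfxy hε0 (by linarith)
  have hEup : f t - f s ≤ (1 + η) * dist t s := by
    rw [hfsub]
    exact hup t s
  have hsteep := peakDiff_sub_of_steep hα0 hαδ hr hno (t := t) (s := s)
  rw [← hfsub] at hsteep
  set E := f t - f s
  set D := dist t s
  rw [hxyr] at hlt
  have hkyx : k y - k x ≤ 2 * r := by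
    rw [← hxyr, dist_comm]
    exact hk y x
  have hkts : k t - k s ≤ D := hk t s
  have hD0 : 0 ≤ D := dist_nonneg
  have hE1 : (1 - ε) * D < E := by
    have h1 : E * (k y - k x) ≤ E * (2 * r) := mul_le_mul_of_nonneg_left hkyx hE
    have h2 : (k t - k s) * (2 * r) ≤ D * (2 * r) :=
      mul_le_mul_of_nonneg_right hkts (by linarith)
    have h3 : (1 - ε) * D * (2 * r) < E * (2 * r) := by linarith
    exact lt_of_mul_lt_mul_right h3 (by linarith)
  have hDpos : 0 < D := by
    rcases hD0.eq_or_lt with h | h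
    · rw [← h] at hE1 hEup
      linarith
    · exact h
  obtain ⟨hsep, hsum⟩ := hsteep (by
    calc D = (1 + α) * ((1 - ε) * D) := by rw [← mul_assoc, hε1, one_mul]
      _ < _ := mul_lt_mul_of_pos_left hE1 (by linarith))
  have hE2 : D < (1 + α) * E := by
    calc D = (1 + α) * ((1 - ε) * D) := by rw [← mul_assoc, hε1, one_mul]
      _ < _ := mul_lt_mul_of_pos_left hE1 (by linarith)
  -- `k` almost attains its norm at both pairs `(t, s)` and `(y, x)`
  have hk1 : (1 - ε - η) * D ≤ k t - k s := by
    have h1 : E * (k y - k x) ≤ E * (2 * r) := mul_le_mul_of_nonneg_left hkyx hE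
    have h2 : E * (2 * r) ≤ (1 + η) * D * (2 * r) :=
      mul_le_mul_of_nonneg_right hEup (by linarith)
    have h3 : (1 - ε - η) * D * (2 * r) ≤ (k t - k s) * (2 * r) := by linarith
    exact le_of_mul_le_mul_right h3 (by linarith)
  have hk2 : (1 - ε - η) * (2 * r) ≤ k y - k x := by
    have h2 : (k t - k s) * (2 * r) ≤ D * (2 * r) :=
      mul_le_mul_of_nonneg_right hkts (by linarith)
    have h3 : (1 - ε) * (2 * r) * D < E * (k y - k x) := by linarith
    have h4 : 0 < k y - k x := by
      refine pos_of_mul_pos_right (lt_trans ?_ h3) hE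
      have : 0 < 1 - ε := by linarith
      positivity
    have h5 : E * (k y - k x) ≤ (1 + η) * D * (k y - k x) :=
      mul_le_mul_of_nonneg_right hEup h4.le
    have h6 : (1 - ε) * (2 * r) < (1 + η) * (k y - k x) := by
      refine lt_of_mul_lt_mul_right (h3.trans_le (h5.trans_eq ?_)) hD0
      ring
    have h7 : η * (k y - k x) ≤ η * (2 * r) := mul_le_mul_of_nonneg_left hkyx hη0.le
    linarith
  have hxt : k t - k x ≤ dist x t := by rw [dist_comm]; exact hk t x
  have hys : k y - k s ≤ dist s y := by rw [dist_comm]; exact hk y s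
  have hfin1 : (2 - ε - η) * D < (α + ε + η) * (2 * r) := by linarith
  have hfin2 : 1 * D ≤ (2 - ε - η) * D := mul_le_mul_of_nonneg_right (by linarith) hD0
  have hfin3 : (δ - α) * r < (2 * (α + ε + η)) * r := by linarith
  have hfin4 := lt_of_mul_lt_mul_right hfin3 hr.le
  linarith

end Midpoints

theorem theorem3p3 (M : Type*) [MetricSpace M] [CompleteSpace M] (o : M) :
    List.TFAE [
      IsLengthSpace M,
      HasDaugavetProperty (LipZero M o),
      HasDaugavetProperty (LipschitzFreeSpace M o)] := by
  tfae_have 1 → 2 := fun h => h.hasApproxMidpoints.hasDaugavetProperty_lipZero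
  tfae_have 2 → 3 := (freePresentation M o).hasDaugavetProperty
  tfae_have 3 → 1 := fun h => ((freePresentation M o).hasApproxMidpoints h).isLengthSpace
  tfae_finish
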